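/- Let $\mathrm{SO}(n)$ be the group of real $n\times n$ matrices $A$ with $A^{\mathsf T}A=I$ and $\det A=1$, and let $\mathrm{M}(n)=\mathbb{R}^n\times\mathrm{SO}(n)$ be the Euclidean motion group, with multiplication $(x,A)(y,B)=(x+Ay,AB)$, identity $(0,I)$, inverse $(x,A)^{-1}=(-A^{-1}x,A^{-1})$, and measure $d(x,A)$ equal to the product of Lebesgue measure on $\mathbb{R}^n$ and the Haar measure on $\mathrm{SO}(n)$ of total mass $1$. A bounded measurable function $f\colon\mathrm{M}(n)\to\mathbb{C}$ is of positive type if $f(g)=\overline{f(g^{-1})}$ for all $g\in\mathrm{M}(n)$ and $$\int_{\mathrm{M}(n)}\int_{\mathrm{M}(n)} f\bigl((y,B)^{-1}(x,A)\bigr)\,\rho(x,A)\,\overline{\rho(y,B)}\,d(y,B)\,d(x,A)\ \ge\ 0\qquad\text{for all }\rho\in L^1(\mathrm{M}(n)).$$ Let $\mathcal{K}\subseteq\mathbb{R}^n$ be a convex body (a compact convex set with nonempty interior $\mathcal{K}^\circ$), let $G$ be a subgroup of its symmetry group $\mathrm{S}(\mathcal{K})=\{A\in\mathrm{SO}(n):A\mathcal{K}=\mathcal{K}\}$,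 and let $T$ be a set of representatives of the left cosets of $G$ in $\mathrm{SO}(n)$. Let $f\in L^1(\mathrm{M}(n))$ be a bounded real-valued function such that (i) $f$ is continuous and of positive type; (ii) $f(x,A)\le 0$ for all $x\in\mathbb{R}^n$ and $A\in T^{-1}T=\{B^{-1}C: B,C\in T\}$ such that $\mathcal{K}^\circ\cap(x+A\mathcal{K}^\circ)=\emptyset$; (iii) $\lambda=\int_{\mathrm{M}(n)}f(x,A)\,d(x,A)>0$. A packing of congruent copies of $\mathcal{K}$ is a union $\mathcal{P}$ of sets of the form $x+A\mathcal{K}$, $(x,A)\in\mathrm{M}(n)$, with pairwise disjoint interiors. Its upper density is $\limsup_{r\to\infty}\sup_{p\in\mathbb{R}^n}\frac{\operatorname{vol}(B(p,r)\cap\mathcal{P})}{\operatorname{vol}B(p,r)}$, and it has density $\Delta$ if $\lim_{r\to\infty}\frac{\operatorname{vol}(B(p,r)\cap\mathcal{P})}{\operatorname{vol}B(p,r)}=\Delta$ for every $p\in\mathbb{R}^n$, where $B(p,r)$ is the ball of radius $r$ centered at $p$. Then the upper density of every packing of congruent copies of $\mathcal{K}$ is at most $$\frac{f(0,I)}{\lambda}\operatorname{vol}\mathcal{K};$$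 in particular, so is its density, whenever the packing has one. -/

import Mathlib

open MeasureTheory Set Filter Topology
open scoped Pointwise ENNReal

noncomputable section

namespace BodyPacking

/-- Euclidean space `ℝⁿ`. -/
abbrev E (n : ℕ) : Type := EuclideanSpace ℝ (Fin n)

/-- The rotation group `SO(n)`, with the topology inherited from the space of matrices. -/
abbrev SO (n : ℕ) : Type := Matrix.specialOrthogonalGroup (Fin n) ℝ

/-! ### `SO(n)` is a compact topological group; its normalized Haar measure -/

instance instIsTopologicalGroupSO {n : ℕ} : IsTopologicalGroup (SO n) where
  continuous_mul := continuous_mul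
  continuous_inv :=
    Continuous.subtype_mk (f := fun A : SO n => A.1.transpose)
      continuous_subtype_val.matrix_transpose _

theorem mem_SO_iff {n : ℕ} (A : Matrix (Fin n) (Fin n) ℝ) :
    A ∈ Matrix.specialOrthogonalGroup (Fin n) ℝ ↔ A.transpose * A = 1 ∧ A.det = 1 := by
  rw [Matrix.mem_specialOrthogonalGroup_iff, Matrix.mem_orthogonalGroup_iff']

instance instCompactSpaceSO {n : ℕ} : CompactSpace (SO n) := by
  refine isCompact_iff_compactSpace.1 ?_
  have hc : IsClosed {A : Matrix (Fin n) (Fin n) ℝ | A.transpose * A = 1 ∧ A.det = 1} :=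
    (isClosed_eq (by fun_prop) continuous_const).inter
      (isClosed_eq (by fun_prop) continuous_const)
  have hb : IsCompact (Set.pi univ fun _ : Fin n => Set.pi univ fun _ : Fin n =>
      Icc (-1 : ℝ) 1) :=
    isCompact_univ_pi fun _ => isCompact_univ_pi fun _ => isCompact_Icc
  have hs : ((Matrix.specialOrthogonalGroup (Fin n) ℝ : Set (Matrix (Fin n) (Fin n) ℝ)))
      = {A | A.transpose * A = 1 ∧ A.det = 1} := by
    ext A
    exact mem_SO_iff A
  rw [hs]
  refine hb.of_isClosed_subset hc ?_
  intro A ⟨hA, _⟩ i _ j _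
  have h1 : ∑ k, A k j * A k j = 1 := by
    exact (congrFun (congrFun hA j) j).trans (Matrix.one_apply_eq j)
  have h2 : A i j * A i j ≤ 1 := by
    rw [← h1]
    exact Finset.single_le_sum (f := fun k => A k j * A k j)
      (fun k _ => mul_self_nonneg _) (Finset.mem_univ i)
  exact ⟨by nlinarith, by nlinarith⟩

instance instMeasurableSpaceSO {n : ℕ} : MeasurableSpace (SO n) := borel _

instance instBorelSpaceSO {n : ℕ} : BorelSpace (SO n) := ⟨rfl⟩

/-- The Haar measure `dA` of `SO(n)`, normalized to have total mass `1`. -/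
def haarSO (n : ℕ) : Measure (SO n) := Measure.haarMeasure ⊤

/-! ### The Euclidean motion group `M(n)` -/

/-- The rotation `x ↦ A x` of `ℝⁿ`. -/
def rot {n : ℕ} (A : SO n) (x : E n) : E n := WithLp.toLp 2 (A.1.mulVec x.ofLp)

theorem rot_add {n : ℕ} (A : SO n) (x y : E n) : rot A (x + y) = rot A x + rot A y := by
  simp [rot, Matrix.mulVec_add]

theorem rot_neg {n : ℕ} (A : SO n) (x : E n) : rot A (-x) = -rot A x := by
  simp [rot, Matrix.mulVec_neg]

theorem rot_one {n : ℕ} (x : E n) : rot (1 : SO n) x = x := by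
  simp [rot]

theorem rot_mul {n : ℕ} (A B : SO n) (x : E n) : rot (A * B) x = rot A (rot B x) := by
  simp [rot, Matrix.mulVec_mulVec]

/-- The underlying space `ℝⁿ × SO(n)` of the Euclidean motion group, with the product
topology. -/
abbrev Motion (n : ℕ) : Type := E n × SO n

/-- The group structure of the Euclidean motion group:
`(x, A) (y, B) = (x + A y, A B)`, `1 = (0, I)` and `(x, A)⁻¹ = (-A⁻¹ x, A⁻¹)`. -/
instance instGroupMotion {n : ℕ} : Group (Motion n) where
  mul g h := (g.1 + rot g.2 h.1, g.2 * h.2)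
  one := (0, 1)
  inv g := (-rot g.2⁻¹ g.1, g.2⁻¹)
  mul_assoc a b c := by
    refine Prod.ext ?_ (mul_assoc a.2 b.2 c.2)
    change a.1 + rot a.2 b.1 + rot (a.2 * b.2) c.1 = a.1 + rot a.2 (b.1 + rot b.2 c.1)
    rw [rot_mul, rot_add, add_assoc]
  one_mul a := by
    refine Prod.ext ?_ (one_mul a.2)
    change 0 + rot 1 a.1 = a.1
    rw [rot_one, zero_add]
  mul_one a := by
    refine Prod.ext ?_ (mul_one a.2)
    change a.1 + rot a.2 0 = a.1
    simp [rot]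
  inv_mul_cancel a := by
    refine Prod.ext ?_ (inv_mul_cancel a.2)
    change -rot a.2⁻¹ a.1 + rot a.2⁻¹ a.1 = 0
    simp

/-- The measure `d(x, A)` on `M(n)`: Lebesgue measure times normalized Haar measure. -/
def motionMeasure (n : ℕ) : Measure (Motion n) := (volume : Measure (E n)).prod (haarSO n)

/-- The image `x + A S` of a set `S ⊆ ℝⁿ` under the motion `(x, A)`. -/
def move {n : ℕ} (g : Motion n) (S : Set (E n)) : Set (E n) := (fun y => g.1 + rot g.2 y) '' S

/-- A bounded measurable function `f : M(n) → ℂ` is of positive type if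
`f(g) = conj f(g⁻¹)` for all `g` and
`∫ ∫ f(h⁻¹ g) ρ(g) conj ρ(h) dh dg ≥ 0` (a real and nonnegative number) for all `ρ ∈ L¹`. -/
structure IsPositiveType {n : ℕ} (f : Motion n → ℂ) : Prop where
  aestronglyMeasurable : AEStronglyMeasurable f (motionMeasure n)
  bounded : ∃ C : ℝ, ∀ g, ‖f g‖ ≤ C
  hermitian : ∀ g, f g = starRingEnd ℂ (f g⁻¹)
  re_nonneg : ∀ ρ : Motion n → ℂ, Integrable ρ (motionMeasure n) →
    0 ≤ (∫ g, ∫ h, f (h⁻¹ * g) * ρ g * starRingEnd ℂ (ρ h)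
      ∂(motionMeasure n) ∂(motionMeasure n)).re
  im_eq_zero : ∀ ρ : Motion n → ℂ, Integrable ρ (motionMeasure n) →
    (∫ g, ∫ h, f (h⁻¹ * g) * ρ g * starRingEnd ℂ (ρ h)
      ∂(motionMeasure n) ∂(motionMeasure n)).im = 0

/-! ### Packings and their densities -/

/-- The symmetry group `S(K) = {A ∈ SO(n) : A K = K}`. -/
def symmetryGroup {n : ℕ} (K : Set (E n)) : Subgroup (SO n) where
  carrier := {A | rot A '' K = K}
  one_mem' := by
    change rot 1 '' K = K
    simp [rot_one]
  mul_mem' {A B} hA hB := by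
    change rot (A * B) '' K = K
    have : rot (A * B) = rot A ∘ rot B := funext (rot_mul A B)
    rw [this, image_comp]
    exact (congrArg _ hB).trans hA
  inv_mem' {A} hA := by
    change rot A⁻¹ '' K = K
    have hA' : rot A '' K = K := hA
    conv_lhs => rw [← hA']
    rw [← image_comp]
    have : rot A⁻¹ ∘ rot A = id := by
      funext x
      simp [← rot_mul, rot_one]
    rw [this, image_id]

/-- `P` is a packing of congruent (rotated and translated) copies of `K`: it is the union of a
family of copies `x + A K` whose interiors are pairwise disjoint. -/
def IsPacking {n : ℕ} (K P : Set (E n)) : Prop :=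
  ∃ S : Set (Motion n),
    S.Pairwise (fun g h => Disjoint (interior (move g K)) (interior (move h K))) ∧
      P = ⋃ g ∈ S, move g K

/-- The proportion of the ball `B(p, r)` covered by `P`. -/
def coveredFraction {n : ℕ} (P : Set (E n)) (p : E n) (r : ℝ) : ℝ≥0∞ :=
  volume (Metric.ball p r ∩ P) / volume (Metric.ball p r)

/-- `P` has density `Δ`: for every centre `p`, the covered fraction of `B(p, r)` tends to `Δ`
as `r → ∞`. -/
def HasDensity {n : ℕ} (P : Set (E n)) (Δ : ℝ≥0∞) : Prop :=
  ∀ p : E n, Tendsto (coveredFraction P p) atTop (𝓝 Δ)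

/-- The upper density `limsup_{r → ∞} sup_p vol(B(p, r) ∩ P) / vol B(p, r)`. -/
def upperDensity {n : ℕ} (P : Set (E n)) : ℝ≥0∞ :=
  limsup (fun r : ℝ => ⨆ p : E n, coveredFraction P p r) atTop

end BodyPacking

end

/-!
The bound is obtained by testing positivity of `f` against a finite piece of the packing, without
passing to periodic packings.

Write `λ = ∫ f`. Choose the rotations of all copies in `T` (`IsPacking.exists_rotations_mem`), and
let `g₁, …, g_N` be the motions whose translation part lies in a ball of radius `r`. Disjointness of
the interiors makes `f(g_j⁻¹ g_i) ≤ 0` for `i ≠ j`, so the point masses `μ = ∑ δ_{g_i}` satisfy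
`Q(μ, μ) ≤ N f(1)` for the form `Q(ρ, σ) = ∫∫ f(h⁻¹ g) ρ(g) σ(h)`. Let `ν` be the indicator of the
motions whose translation part lies in the concentric ball of radius `r + s`. Since `M(n)` is
unimodular (`measurePreserving_inv_mul`) and rotations preserve length, `∫ f(h⁻¹ g) ν(h) dh` is
within `ε` of `λ` whenever `g` lies over the smaller ball, where `ε` bounds the integral of `|f|`
over translations longer than `s` (`abs_setIntegral_cylinder_sub_le`). Hence `Q(μ, ν) ≥ N (λ - ε)`,
and `Q(ν, ν)` is at most `(λ + ε) vol B(r)` plus a boundary term of lower order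
(`pairing_cylinder_le`). Cauchy–Schwarz, `Q(μ, ν)² ≤ Q(μ, μ) Q(ν, ν)`, gives
`N / vol B(r) ≤ f(1) (λ + ε) / (λ - ε)² + o(1)` (`card_mul_sq_le`), uniformly in the centre of the
ball. The copies that meet a ball of radius `r` have their translation parts in a ball whose radius
is larger by a constant, so letting `r → ∞` and then `ε → 0` bounds the upper density.

Positivity is only assumed against integrable functions; `quadratic_nonneg` extends it to the point
masses by continuity of `f`.
-/

namespace BodyPacking

variable {n : ℕ}

/-! ### Haar measure of `SO(n)` -/

instance instSecondCountableTopologySO : SecondCountableTopology (SO n) :=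
  inferInstanceAs (SecondCountableTopology
    {A : Fin n → Fin n → ℝ // A ∈ Matrix.specialOrthogonalGroup (Fin n) ℝ})

instance instIsHaarMeasureHaarSO : (haarSO n).IsHaarMeasure :=
  Measure.isHaarMeasure_haarMeasure _

instance instIsProbabilityMeasureHaarSO : IsProbabilityMeasure (haarSO n) :=
  ⟨Measure.haarMeasure_self⟩

instance instIsMulRightInvariantHaarSO : (haarSO n).IsMulRightInvariant where
  map_mul_right_eq_self A := by
    have : IsProbabilityMeasure ((haarSO n).map (· * A)) :=
      Measure.isProbabilityMeasure_map (by fun_prop)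
    have : ((haarSO n).map (· * A)).IsHaarMeasure := Measure.isHaarMeasure_map_mul_right _ A
    exact Measure.isHaarMeasure_eq_of_isProbabilityMeasure _ _

instance instIsInvInvariantHaarSO : (haarSO n).IsInvInvariant where
  inv_eq_self := by
    have : IsProbabilityMeasure (haarSO n).inv :=
      Measure.isProbabilityMeasure_map (by fun_prop)
    have h := Measure.isMulInvariant_eq_smul_of_compactSpace (haarSO n).inv (haarSO n)
    have h1 := congrArg (fun ν : Measure (SO n) => ν univ) h
    simp only [Measure.smul_apply, measure_univ, ENNReal.smul_def, smul_eq_mul, mul_one] at h1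
    rw [h, ENNReal.smul_def, ← h1, one_smul]

/-! ### Rotations and motions -/

theorem norm_rot (A : SO n) (x : E n) : ‖rot A x‖ = ‖x‖ := by
  have hA : (A.1).transpose * A.1 = 1 := ((mem_SO_iff A.1).1 A.2).1
  have key (y : E n) : ‖y‖ ^ 2 = y.ofLp ⬝ᵥ y.ofLp := by
    rw [EuclideanSpace.real_norm_sq_eq]
    simp [dotProduct, sq]
  rw [← sq_eq_sq₀ (norm_nonneg _) (norm_nonneg _), key, key]
  change A.1.mulVec x.ofLp ⬝ᵥ A.1.mulVec x.ofLp = _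
  rw [Matrix.dotProduct_mulVec, ← Matrix.mulVec_transpose, Matrix.mulVec_mulVec, hA,
    Matrix.one_mulVec]

/-- The rotation `x ↦ A x` as a linear isometry of `ℝⁿ`. -/
def rotIsometry (A : SO n) : E n ≃ₗᵢ[ℝ] E n where
  toFun := rot A
  invFun := rot A⁻¹
  left_inv x := by rw [← rot_mul, inv_mul_cancel, rot_one]
  right_inv x := by rw [← rot_mul, mul_inv_cancel, rot_one]
  map_add' := rot_add A
  map_smul' c x := by simp [rot, Matrix.mulVec_smul]
  norm_map' := norm_rot A

theorem continuous_rot : Continuous fun p : SO n × E n => rot p.1 p.2 := by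
  unfold rot
  refine (PiLp.continuous_toLp 2 _).comp ?_
  exact (continuous_subtype_val.comp continuous_fst).matrix_mulVec
    ((PiLp.continuous_ofLp 2 _).comp continuous_snd)

theorem inv_mul_fst (h g : Motion n) : (h⁻¹ * g).1 = rot h.2⁻¹ (g.1 - h.1) := by
  change -rot h.2⁻¹ h.1 + rot h.2⁻¹ g.1 = _
  rw [sub_eq_add_neg, rot_add, rot_neg, add_comm]

theorem inv_mul_eq (h g : Motion n) : h⁻¹ * g = (rot h.2⁻¹ (g.1 - h.1), h.2⁻¹ * g.2) :=
  Prod.ext (inv_mul_fst h g) rfl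

theorem norm_inv_mul_fst (h g : Motion n) : ‖(h⁻¹ * g).1‖ = ‖g.1 - h.1‖ := by
  rw [inv_mul_fst, norm_rot]

theorem continuous_inv_mul_motion :
    Continuous fun p : Motion n × Motion n => p.2⁻¹ * p.1 := by
  simp only [inv_mul_eq]
  refine (continuous_rot.comp (f := fun p : Motion n × Motion n =>
    ((p.2.2)⁻¹, p.1.1 - p.2.1)) (by fun_prop)).prodMk (by fun_prop)

instance instSFiniteMotionMeasure : SFinite (motionMeasure n) := by
  unfold motionMeasure; infer_instance

instance instIsOpenPosMeasureMotionMeasure : (motionMeasure n).IsOpenPosMeasure := by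
  unfold motionMeasure; infer_instance

/-- Inversion followed by a right translation preserves the measure: the Euclidean motion group
is unimodular. -/
theorem measurePreserving_inv_mul (g : Motion n) :
    MeasurePreserving (fun h : Motion n => h⁻¹ * g) (motionMeasure n) (motionMeasure n) := by
  have hSO : MeasurePreserving (fun B : SO n => B⁻¹ * g.2) (haarSO n) (haarSO n) :=
    (measurePreserving_mul_right (haarSO n) g.2).comp (Measure.measurePreserving_inv (haarSO n))
  have hskew : MeasurePreserving
      (fun p : SO n × E n => (p.1⁻¹ * g.2, rot p.1⁻¹ (g.1 - p.2)))
      ((haarSO n).prod volume) ((haarSO n).prod volume) := by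
    refine hSO.skew_product (g := fun B y => rot B⁻¹ (g.1 - y)) ?_ (ae_of_all _ fun B => ?_)
    · exact (continuous_rot.comp (f := fun p : SO n × E n => ((p.1)⁻¹, g.1 - p.2))
        (by fun_prop)).measurable
    · exact ((rotIsometry B⁻¹).measurePreserving.comp
        (Measure.measurePreserving_sub_left volume g.1)).map_eq
  have h := (Measure.measurePreserving_swap.comp hskew).comp
    (Measure.measurePreserving_swap (μ := (volume : Measure (E n))) (ν := haarSO n))
  unfold motionMeasure
  convert h using 1
  ext1 h
  exact inv_mul_eq h g

theorem integral_inv_mul {F : Motion n → ℝ} (hF : AEStronglyMeasurable F (motionMeasure n))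
    (g : Motion n) :
    ∫ h, F (h⁻¹ * g) ∂(motionMeasure n) = ∫ h, F h ∂(motionMeasure n) := by
  have hg := measurePreserving_inv_mul g
  conv_rhs => rw [← hg.map_eq]
  rw [integral_map hg.aemeasurable (by rwa [hg.map_eq])]

theorem integrable_inv_mul {F : Motion n → ℝ} (hF : Integrable F (motionMeasure n))
    (g : Motion n) : Integrable (fun h => F (h⁻¹ * g)) (motionMeasure n) :=
  (measurePreserving_inv_mul g).integrable_comp_of_integrable hF

/-- The motions whose translation part lies in the ball `B(p, r)`. -/
def cylinder (p : E n) (r : ℝ) : Set (Motion n) := Metric.ball p r ×ˢ univ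

theorem isOpen_cylinder (p : E n) (r : ℝ) : IsOpen (cylinder p r) :=
  Metric.isOpen_ball.prod isOpen_univ

theorem motionMeasure_cylinder (p : E n) (r : ℝ) :
    motionMeasure n (cylinder p r) = volume (Metric.ball p r) := by
  simp [motionMeasure, cylinder, Measure.prod_prod]

theorem motionMeasure_cylinder_ne_top (p : E n) (r : ℝ) :
    motionMeasure n (cylinder p r) ≠ ∞ := by
  rw [motionMeasure_cylinder]; exact measure_ball_lt_top.ne

/-- An integrable function has a small integral over the motions with a long translation. -/
theorem exists_tail_le {f : Motion n → ℝ} (hf : Integrable f (motionMeasure n)) {ε : ℝ}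
    (hε : 0 < ε) :
    ∃ s : ℝ, 0 < s ∧ ∫ g in {g : Motion n | s ≤ ‖g.1‖}, |f g| ∂(motionMeasure n) ≤ ε := by
  have h := tendsto_setIntegral_of_antitone (μ := motionMeasure n) (f := fun g => |f g|)
    (s := fun s : ℝ => {g : Motion n | s ≤ ‖g.1‖})
    (fun s => (isClosed_le (by fun_prop) (by fun_prop)).measurableSet)
    (fun s t hst g hg => hst.trans hg) ⟨0, hf.abs.integrableOn⟩
  have hempty : ⋂ s : ℝ, {g : Motion n | s ≤ ‖g.1‖} = ∅ := by
    refine eq_empty_of_forall_notMem fun g hg => ?_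
    have := mem_iInter.1 hg (‖g.1‖ + 1)
    simp only [mem_ofPred_eq] at this
    linarith
  rw [hempty, setIntegral_empty] at h
  obtain ⟨s, hs, hs0⟩ := ((h.eventually_le_const hε).and (eventually_gt_atTop 0)).exists
  exact ⟨s, hs0, hs⟩

/-- For `g` over `B(p, r)`, every `h` outside the cylinder over `B(p, r + s)` has `h⁻¹ g` with
translation part of length at least `s`. Hence the integral of `f(h⁻¹ g)` over that cylinder differs
from the total integral by at most the tail of `f` beyond `s`. -/
theorem abs_setIntegral_cylinder_sub_le {f : Motion n → ℝ} (hf : Integrable f (motionMeasure n))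
    {s r : ℝ} {p : E n} {g : Motion n} (hg : g ∈ cylinder p r) :
    |∫ h in cylinder p (r + s), f (h⁻¹ * g) ∂(motionMeasure n) - ∫ h, f h ∂(motionMeasure n)| ≤
      ∫ h in {h : Motion n | s ≤ ‖h.1‖}, |f h| ∂(motionMeasure n) := by
  have hm : MeasurableSet (cylinder p (r + s)) := (isOpen_cylinder _ _).measurableSet
  have hs : MeasurableSet {h : Motion n | s ≤ ‖h.1‖} :=
    (isClosed_le (by fun_prop) (by fun_prop)).measurableSet
  have hi := integrable_inv_mul hf g
  rw [← integral_inv_mul hf.aestronglyMeasurable g, ← integral_add_compl hm hi,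
    sub_add_cancel_left, abs_neg]
  refine (abs_integral_le_integral_abs).trans ?_
  have hia : Integrable ({h : Motion n | s ≤ ‖h.1‖}.indicator fun h => |f h|)
      (motionMeasure n) := hf.abs.indicator hs
  rw [← integral_indicator hm.compl, ← integral_indicator hs,
    ← integral_inv_mul hia.aestronglyMeasurable g]
  refine integral_mono (hi.abs.indicator hm.compl) (integrable_inv_mul hia g) fun h => ?_
  by_cases hh : h ∈ (cylinder p (r + s))ᶜ
  · have hfar : h⁻¹ * g ∈ {h : Motion n | s ≤ ‖h.1‖} := by
      simp only [cylinder, mem_compl_iff, mem_prod, Metric.mem_ball, mem_univ, and_true,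
        not_lt] at hh hg
      simp only [mem_ofPred_eq, norm_inv_mul_fst, ← dist_eq_norm]
      have := dist_triangle h.1 g.1 p
      rw [dist_comm h.1 g.1] at this
      linarith
    simp only [indicator_of_mem hh, indicator_of_mem hfar, le_refl]
  · rw [indicator_of_notMem hh]
    exact indicator_nonneg (fun _ _ => abs_nonneg _) _

/-! ### The quadratic form of a function of positive type -/

/-- The bilinear form `∫ f(h⁻¹ g) ρ(g) σ(h) d(g, h)` attached to `f`, on real functions. -/
noncomputable def pairing (f ρ σ : Motion n → ℝ) : ℝ :=
  ∫ p : Motion n × Motion n, f (p.2⁻¹ * p.1) * (ρ p.1 * σ p.2)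
    ∂((motionMeasure n).prod (motionMeasure n))

section pairing

variable {f ρ σ τ : Motion n → ℝ} {C : ℝ}

theorem integrable_pairing (hf : Continuous f) (hC : ∀ g, |f g| ≤ C)
    (hρ : Integrable ρ (motionMeasure n)) (hσ : Integrable σ (motionMeasure n)) :
    Integrable (fun p : Motion n × Motion n => f (p.2⁻¹ * p.1) * (ρ p.1 * σ p.2))
      ((motionMeasure n).prod (motionMeasure n)) :=
  (hρ.mul_prod hσ).bdd_mul (c := C)
    (hf.comp continuous_inv_mul_motion).aestronglyMeasurable (ae_of_all _ fun _ => hC _)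

theorem pairing_comm (hsymm : ∀ g, f g⁻¹ = f g) (ρ σ : Motion n → ℝ) :
    pairing f ρ σ = pairing f σ ρ := by
  unfold pairing
  rw [← integral_prod_swap]
  refine integral_congr_ae (ae_of_all _ fun p => ?_)
  simp only [Prod.fst_swap, Prod.snd_swap]
  rw [← hsymm, mul_inv_rev, inv_inv, mul_comm (ρ p.2)]

theorem pairing_sub_left (hf : Continuous f) (hC : ∀ g, |f g| ≤ C)
    (hρ : Integrable ρ (motionMeasure n)) (hσ : Integrable σ (motionMeasure n))
    (hτ : Integrable τ (motionMeasure n)) :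
    pairing f (ρ - σ) τ = pairing f ρ τ - pairing f σ τ := by
  unfold pairing
  rw [← integral_sub (integrable_pairing hf hC hρ hτ) (integrable_pairing hf hC hσ hτ)]
  refine integral_congr_ae (ae_of_all _ fun p => ?_)
  simp only [Pi.sub_apply]
  ring

theorem pairing_smul_left (t : ℝ) (ρ σ : Motion n → ℝ) :
    pairing f (t • ρ) σ = t * pairing f ρ σ := by
  unfold pairing
  rw [← integral_const_mul]
  refine integral_congr_ae (ae_of_all _ fun p => ?_)
  simp only [Pi.smul_apply, smul_eq_mul]
  ring

theorem pairing_sum_left {ι : Type*} (s : Finset ι) {φ : ι → Motion n → ℝ}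
    (hf : Continuous f) (hC : ∀ g, |f g| ≤ C)
    (hφ : ∀ i ∈ s, Integrable (φ i) (motionMeasure n)) (hσ : Integrable σ (motionMeasure n)) :
    pairing f (∑ i ∈ s, φ i) σ = ∑ i ∈ s, pairing f (φ i) σ := by
  unfold pairing
  rw [← integral_finsetSum _ fun i hi => integrable_pairing hf hC (hφ i hi) hσ]
  refine integral_congr_ae (ae_of_all _ fun p => ?_)
  simp only [Finset.sum_apply, Finset.sum_mul, Finset.mul_sum]

theorem pairing_eq_integral (hf : Continuous f) (hC : ∀ g, |f g| ≤ C)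
    (hρ : Integrable ρ (motionMeasure n)) (hσ : Integrable σ (motionMeasure n)) :
    pairing f ρ σ =
      ∫ g, ρ g * ∫ h, f (h⁻¹ * g) * σ h ∂(motionMeasure n) ∂(motionMeasure n) := by
  unfold pairing
  rw [integral_prod _ (integrable_pairing hf hC hρ hσ)]
  refine integral_congr_ae (ae_of_all _ fun g => ?_)
  simp only
  rw [← integral_const_mul]
  refine integral_congr_ae (ae_of_all _ fun h => ?_)
  simp only
  ring

theorem integrable_mul_integral (hf : Continuous f) (hC : ∀ g, |f g| ≤ C)
    (hρ : Integrable ρ (motionMeasure n)) (hσ : Integrable σ (motionMeasure n)) :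
    Integrable (fun g => ρ g * ∫ h, f (h⁻¹ * g) * σ h ∂(motionMeasure n)) (motionMeasure n) := by
  refine (integrable_pairing hf hC hρ hσ).integral_prod_left.congr (ae_of_all _ fun g => ?_)
  simp only
  rw [← integral_const_mul]
  refine integral_congr_ae (ae_of_all _ fun h => ?_)
  simp only
  ring

theorem pairing_self_nonneg (hpos : IsPositiveType fun g => (f g : ℂ)) (hf : Continuous f)
    (hρ : Integrable ρ (motionMeasure n)) : 0 ≤ pairing f ρ ρ := by
  obtain ⟨C, hC⟩ := hpos.bounded
  have hC' (g : Motion n) : |f g| ≤ C := by simpa using hC g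
  have h := hpos.re_nonneg (fun g => (ρ g : ℂ)) hρ.ofReal
  have key : (∫ g, ∫ h, (f (h⁻¹ * g) : ℂ) * (ρ g : ℂ) * starRingEnd ℂ (ρ h : ℂ)
      ∂(motionMeasure n) ∂(motionMeasure n)) = (pairing f ρ ρ : ℂ) := by
    unfold pairing
    rw [integral_prod _ (integrable_pairing hf hC' hρ hρ), ← integral_complex_ofReal]
    refine integral_congr_ae (ae_of_all _ fun g => ?_)
    simp only
    rw [← integral_complex_ofReal]
    refine integral_congr_ae (ae_of_all _ fun h => ?_)
    simp [mul_assoc]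
  rw [key, Complex.ofReal_re] at h
  exact h

/-- Against two probability densities supported in `U` and `V`, the form is at most any upper bound
of `f(h⁻¹ g)` over `g ∈ U`, `h ∈ V`. -/
theorem pairing_le_of_density (hf : Continuous f) (hC : ∀ g, |f g| ≤ C)
    (hρ : Integrable ρ (motionMeasure n)) (hσ : Integrable σ (motionMeasure n))
    (hρ0 : 0 ≤ ρ) (hσ0 : 0 ≤ σ) (hρ1 : ∫ g, ρ g ∂(motionMeasure n) = 1)
    (hσ1 : ∫ g, σ g ∂(motionMeasure n) = 1) {U V : Set (Motion n)}
    (hρU : ∀ g ∉ U, ρ g = 0) (hσV : ∀ g ∉ V, σ g = 0) {c : ℝ}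
    (hc : ∀ g ∈ U, ∀ h ∈ V, f (h⁻¹ * g) ≤ c) : pairing f ρ σ ≤ c := by
  have h1 : ∫ p : Motion n × Motion n, c * (ρ p.1 * σ p.2)
      ∂((motionMeasure n).prod (motionMeasure n)) = c := by
    rw [integral_const_mul, integral_prod_mul, hρ1, hσ1, one_mul, mul_one]
  rw [← h1]
  refine integral_mono (integrable_pairing hf hC hρ hσ) ((hρ.mul_prod hσ).const_mul c)
    fun p => ?_
  by_cases hp : p.1 ∈ U ∧ p.2 ∈ V
  · exact mul_le_mul_of_nonneg_right (hc _ hp.1 _ hp.2) (mul_nonneg (hρ0 _) (hσ0 _))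
  · rcases not_and_or.1 hp with hp | hp
    · simp [hρU _ hp]
    · simp [hσV _ hp]

/-- Against a probability density supported in `U`, the form is at least any lower bound of
`∫ f(h⁻¹ g) σ(h) dh` over `g ∈ U`. -/
theorem le_pairing_of_density (hf : Continuous f) (hC : ∀ g, |f g| ≤ C)
    (hρ : Integrable ρ (motionMeasure n)) (hσ : Integrable σ (motionMeasure n))
    (hρ0 : 0 ≤ ρ) (hρ1 : ∫ g, ρ g ∂(motionMeasure n) = 1) {U : Set (Motion n)}
    (hρU : ∀ g ∉ U, ρ g = 0) {a : ℝ}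
    (ha : ∀ g ∈ U, a ≤ ∫ h, f (h⁻¹ * g) * σ h ∂(motionMeasure n)) : a ≤ pairing f ρ σ := by
  have h1 : ∫ g, ρ g * a ∂(motionMeasure n) = a := by
    rw [integral_mul_const, hρ1, one_mul]
  rw [pairing_eq_integral hf hC hρ hσ, ← h1]
  refine integral_mono (hρ.mul_const a) (integrable_mul_integral hf hC hρ hσ) fun g => ?_
  by_cases hg : g ∈ U
  · exact mul_le_mul_of_nonneg_left (ha g hg) (hρ0 g)
  · simp [hρU g hg]

/-- The value of the form at `∑ φᵢ - t σ`. -/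
theorem pairing_sum_sub_smul {ι : Type*} (s : Finset ι) {φ : ι → Motion n → ℝ}
    (hf : Continuous f) (hC : ∀ g, |f g| ≤ C) (hsymm : ∀ g, f g⁻¹ = f g)
    (hφ : ∀ i ∈ s, Integrable (φ i) (motionMeasure n)) (hσ : Integrable σ (motionMeasure n))
    (t : ℝ) :
    pairing f (∑ i ∈ s, φ i - t • σ) (∑ i ∈ s, φ i - t • σ) =
      ∑ i ∈ s, ∑ j ∈ s, pairing f (φ i) (φ j) - 2 * t * ∑ i ∈ s, pairing f (φ i) σ +
        t ^ 2 * pairing f σ σ := by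
  have hsum : Integrable (∑ i ∈ s, φ i) (motionMeasure n) := integrable_finsetSum' s hφ
  have htσ : Integrable (t • σ) (motionMeasure n) := hσ.smul t
  have hdiff := hsum.sub htσ
  have hφφ : pairing f (∑ i ∈ s, φ i) (∑ i ∈ s, φ i) =
      ∑ i ∈ s, ∑ j ∈ s, pairing f (φ i) (φ j) := by
    rw [pairing_sum_left s hf hC hφ hsum]
    refine Finset.sum_congr rfl fun i hi => ?_
    rw [pairing_comm hsymm, pairing_sum_left s hf hC hφ (hφ i hi)]
    exact Finset.sum_congr rfl fun j _ => pairing_comm hsymm _ _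
  have hφσ : pairing f (∑ i ∈ s, φ i) σ = ∑ i ∈ s, pairing f (φ i) σ :=
    pairing_sum_left s hf hC hφ hσ
  rw [pairing_sub_left hf hC hsum htσ hdiff, pairing_comm hsymm _ (_ - _),
    pairing_comm hsymm (t • σ) (_ - _), pairing_sub_left hf hC hsum htσ hsum,
    pairing_sub_left hf hC hsum htσ htσ, pairing_comm hsymm _ (t • σ),
    pairing_smul_left, pairing_smul_left, pairing_comm hsymm σ (t • σ),
    pairing_smul_left, pairing_comm hsymm σ, hφφ, hφσ]
  ring

end pairing

/-! ### Point configurations tested against a cylinder -/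

/-- The uniform probability density on a set of finite positive measure. -/
noncomputable def uniformDensity (W : Set (Motion n)) : Motion n → ℝ :=
  W.indicator fun _ => ((motionMeasure n).real W)⁻¹

theorem uniformDensity_nonneg (W : Set (Motion n)) : 0 ≤ uniformDensity W :=
  indicator_nonneg fun _ _ => inv_nonneg.2 measureReal_nonneg

theorem integrable_uniformDensity {W : Set (Motion n)} (hW : MeasurableSet W)
    (hfin : motionMeasure n W ≠ ∞) : Integrable (uniformDensity W) (motionMeasure n) :=
  (integrable_indicator_iff hW).2 (integrableOn_const hfin)

theorem integral_uniformDensity {W : Set (Motion n)} (hW : IsOpen W) (hne : W.Nonempty)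
    (hfin : motionMeasure n W ≠ ∞) : ∫ g, uniformDensity W g ∂(motionMeasure n) = 1 := by
  unfold uniformDensity
  rw [integral_indicator hW.measurableSet, setIntegral_const, smul_eq_mul]
  exact mul_inv_cancel₀ (measureReal_ne_zero_iff hfin |>.2 (hW.measure_pos _ hne).ne')

/-- Positivity of the form, tested at `∑_{g ∈ F} δ_g - t σ`. The point masses `δ_g` are not
integrable functions; they are approximated by uniform densities on small neighbourhoods, over
which the continuous function `f(h⁻¹ g)` varies by at most `η`, and then `η → 0`. -/
theorem quadratic_nonneg {f σ : Motion n → ℝ} (hpos : IsPositiveType fun g => (f g : ℂ))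
    (hf : Continuous f) {F : Finset (Motion n)}
    (hF : ∀ g ∈ F, ∀ h ∈ F, g ≠ h → f (h⁻¹ * g) ≤ 0) {U : Set (Motion n)} (hU : IsOpen U)
    (hUfin : motionMeasure n U ≠ ∞) (hFU : ∀ g ∈ F, g ∈ U)
    (hσ : Integrable σ (motionMeasure n)) {a : ℝ}
    (ha : ∀ g ∈ U, a ≤ ∫ h, f (h⁻¹ * g) * σ h ∂(motionMeasure n)) {t : ℝ} (ht : 0 ≤ t) :
    0 ≤ F.card * f 1 - 2 * t * (F.card * a) + t ^ 2 * pairing f σ σ := by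
  classical
  obtain ⟨C, hC⟩ := hpos.bounded
  replace hC (g : Motion n) : |f g| ≤ C := by simpa using hC g
  have hsymm (g : Motion n) : f g⁻¹ = f g := by
    have h := hpos.hermitian g
    rw [Complex.conj_ofReal] at h
    exact_mod_cast h.symm
  -- the bound with an error `η` for each pair of points
  have key (η : ℝ) (hη : 0 < η) :
      0 ≤ F.card * f 1 - 2 * t * (F.card * a) + t ^ 2 * pairing f σ σ + F.card * F.card * η := by
    have hnear (g h : Motion n) : ∃ u v : Set (Motion n), IsOpen u ∧ g ∈ u ∧ IsOpen v ∧ h ∈ v ∧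
        ∀ g' ∈ u, ∀ h' ∈ v, f (h'⁻¹ * g') ≤ f (h⁻¹ * g) + η := by
      have hev : ∀ᶠ p : Motion n × Motion n in 𝓝 (g, h),
          f (p.2⁻¹ * p.1) < f (h⁻¹ * g) + η :=
        ((hf.comp continuous_inv_mul_motion).tendsto (g, h)).eventually_lt_const
          (lt_add_of_pos_right _ hη)
      obtain ⟨u, v, hu, hgu, hv, hhv, huv⟩ := mem_nhds_prod_iff'.1 hev
      exact ⟨u, v, hu, hgu, hv, hhv, fun g' hg' h' hh' => (huv (mk_mem_prod hg' hh')).le⟩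
    choose u v hu hgu hv hhv huv using hnear
    let W (g : Motion n) : Set (Motion n) := U ∩ ((⋂ h ∈ F, u g h) ∩ ⋂ h ∈ F, v h g)
    have hW (g : Motion n) : IsOpen (W g) :=
      hU.inter ((isOpen_biInter_finset fun h _ => hu g h).inter
        (isOpen_biInter_finset fun h _ => hv h g))
    have hgW (g : Motion n) (hg : g ∈ F) : g ∈ W g :=
      ⟨hFU g hg, mem_iInter₂.2 fun h _ => hgu g h, mem_iInter₂.2 fun h _ => hhv h g⟩
    have hWfin (g : Motion n) : motionMeasure n (W g) ≠ ∞ :=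
      measure_ne_top_of_subset inter_subset_left hUfin
    let φ (g : Motion n) : Motion n → ℝ := uniformDensity (W g)
    have hφi (g : Motion n) : Integrable (φ g) (motionMeasure n) :=
      integrable_uniformDensity (hW g).measurableSet (hWfin g)
    have hφ1 (g : Motion n) (hg : g ∈ F) : ∫ h, φ g h ∂(motionMeasure n) = 1 :=
      integral_uniformDensity (hW g) ⟨g, hgW g hg⟩ (hWfin g)
    have hφW (g : Motion n) : ∀ h ∉ W g, φ g h = 0 := fun h hh => indicator_of_notMem hh _
    have hsq : ∑ g ∈ F, ∑ h ∈ F, pairing f (φ g) (φ h) ≤ F.card * f 1 + F.card * F.card * η := by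
      calc ∑ g ∈ F, ∑ h ∈ F, pairing f (φ g) (φ h)
          ≤ ∑ g ∈ F, ∑ h ∈ F, ((if g = h then f 1 else 0) + η) := by
            refine Finset.sum_le_sum fun g hg => Finset.sum_le_sum fun h hh => ?_
            refine (pairing_le_of_density hf hC (hφi g) (hφi h) (uniformDensity_nonneg _)
              (uniformDensity_nonneg _) (hφ1 g hg) (hφ1 h hh) (hφW g) (hφW h)
              fun g' hg' h' hh' => huv g h g' (mem_iInter₂.1 hg'.2.1 h hh) h'
                (mem_iInter₂.1 hh'.2.2 g hg)).trans ?_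
            split_ifs with hgh
            · rw [hgh, inv_mul_cancel]
            · exact add_le_add_left (hF g hg h hh hgh) η
        _ = F.card * f 1 + F.card * F.card * η := by
            simp only [Finset.sum_add_distrib, Finset.sum_const, nsmul_eq_mul]
            rw [Finset.sum_congr rfl fun g hg => by rw [Finset.sum_ite_eq, if_pos hg],
              Finset.sum_const, nsmul_eq_mul]
            ring
    have hcross : F.card * a ≤ ∑ g ∈ F, pairing f (φ g) σ := by
      rw [← nsmul_eq_mul]
      exact Finset.card_nsmul_le_sum _ _ _ fun g hg =>
        le_pairing_of_density hf hC (hφi g) hσ (uniformDensity_nonneg _) (hφ1 g hg) (hφW g)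
          fun g' hg' => ha g' hg'.1
    have hQ := pairing_self_nonneg hpos hf
      ((integrable_finsetSum' F fun g _ => hφi g).sub (hσ.smul t))
    rw [pairing_sum_sub_smul F hf hC hsymm (fun g _ => hφi g) hσ t] at hQ
    have := mul_le_mul_of_nonneg_left hcross (mul_nonneg zero_le_two ht)
    linarith
  refine ge_of_tendsto (x := 𝓝[>] (0 : ℝ)) (f := fun η : ℝ => F.card * f 1 -
    2 * t * (F.card * a) + t ^ 2 * pairing f σ σ + F.card * F.card * η) ?_
    (eventually_mem_nhdsWithin.mono fun η hη => key η hη)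
  refine tendsto_nhdsWithin_of_tendsto_nhds (Continuous.tendsto' (by fun_prop) _ _ (by simp))

theorem apply_one_nonneg {f : Motion n → ℝ} (hpos : IsPositiveType fun g => (f g : ℂ))
    (hf : Continuous f) : 0 ≤ f 1 := by
  have h := quadratic_nonneg (σ := 0) (F := {1}) (U := cylinder 0 1) (a := 0) (t := 0) hpos hf
    (fun g hg h hh hne => by simp_all) (isOpen_cylinder _ _) (motionMeasure_cylinder_ne_top _ _)
    (fun g hg => by
      rw [Finset.mem_singleton.1 hg]
      exact ⟨Metric.mem_ball_self one_pos, mem_univ _⟩)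
    (integrable_zero _ _ _) (fun g _ => by simp) le_rfl
  simpa using h

/-- The Cauchy–Schwarz consequence of `quadratic_nonneg`, from the optimal choice of `t`. -/
theorem card_mul_sq_le {f σ : Motion n → ℝ} (hpos : IsPositiveType fun g => (f g : ℂ))
    (hf : Continuous f) {F : Finset (Motion n)}
    (hF : ∀ g ∈ F, ∀ h ∈ F, g ≠ h → f (h⁻¹ * g) ≤ 0) {U : Set (Motion n)} (hU : IsOpen U)
    (hUfin : motionMeasure n U ≠ ∞) (hFU : ∀ g ∈ F, g ∈ U)
    (hσ : Integrable σ (motionMeasure n)) {a : ℝ} (ha0 : 0 ≤ a)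
    (ha : ∀ g ∈ U, a ≤ ∫ h, f (h⁻¹ * g) * σ h ∂(motionMeasure n)) {w : ℝ} (hw : 0 < w)
    (hσw : pairing f σ σ ≤ w) : F.card * a ^ 2 ≤ f 1 * w := by
  rcases F.eq_empty_or_nonempty with rfl | hne
  · simpa using mul_nonneg (apply_one_nonneg hpos hf) hw.le
  have hN : (0 : ℝ) < F.card := by exact_mod_cast hne.card_pos
  have h := quadratic_nonneg hpos hf hF hU hUfin hFU hσ ha (t := F.card * a / w) (by positivity)
  have h2 : (F.card * a / w) ^ 2 * pairing f σ σ ≤ (F.card * a / w) ^ 2 * w :=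
    mul_le_mul_of_nonneg_left hσw (sq_nonneg _)
  have h3 : (0 : ℝ) ≤ F.card * f 1 - 2 * (F.card * a / w) * (F.card * a) +
      (F.card * a / w) ^ 2 * w := by linarith
  have h4 : F.card * f 1 - 2 * (F.card * a / w) * (F.card * a) + (F.card * a / w) ^ 2 * w =
      F.card / w * (f 1 * w - F.card * a ^ 2) := by
    field_simp
    ring
  rw [h4] at h3
  linarith [nonneg_of_mul_nonneg_right h3 (by positivity)]

/-- The self-pairing of a cylinder of radius `r + s` is at most `vol B(p, r) (λ + ε)` up to the
contribution of the boundary layer, where `ε` bounds the tail of `f` beyond `s`. -/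
theorem pairing_cylinder_le {f : Motion n → ℝ} {C : ℝ} (hf : Continuous f)
    (hC : ∀ g, |f g| ≤ C) (hint : Integrable f (motionMeasure n)) {s ε : ℝ} (hs : 0 ≤ s)
    (hε : ∫ h in {h : Motion n | s ≤ ‖h.1‖}, |f h| ∂(motionMeasure n) ≤ ε) (p : E n) (r : ℝ) :
    pairing f ((cylinder p (r + s)).indicator 1) ((cylinder p (r + s)).indicator 1) ≤
      volume.real (Metric.ball p r) * (∫ h, f h ∂(motionMeasure n) + ε) +
        (volume.real (Metric.ball p (r + s)) - volume.real (Metric.ball p r)) *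
          ∫ h, |f h| ∂(motionMeasure n) := by
  set R := cylinder p (r + s)
  set I := cylinder p r
  have hR : MeasurableSet R := (isOpen_cylinder _ _).measurableSet
  have hI : MeasurableSet I := (isOpen_cylinder _ _).measurableSet
  have hIR : I ⊆ R := prod_mono (Metric.ball_subset_ball (by linarith)) subset_rfl
  have hRfin : motionMeasure n R ≠ ∞ := motionMeasure_cylinder_ne_top _ _
  have hσ : Integrable (R.indicator 1 : Motion n → ℝ) (motionMeasure n) :=
    (integrable_indicator_iff hR).2 (integrableOn_const hRfin)
  have hvol (q : ℝ) : (motionMeasure n).real (cylinder p q) = volume.real (Metric.ball p q) := by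
    simp [measureReal_def, motionMeasure_cylinder]
  have hinner (g : Motion n) : ∫ h, f (h⁻¹ * g) * R.indicator 1 h ∂(motionMeasure n) =
      ∫ h in R, f (h⁻¹ * g) ∂(motionMeasure n) := by
    rw [← integral_indicator hR]
    refine integral_congr_ae (ae_of_all _ fun h => ?_)
    by_cases hh : h ∈ R <;> simp [hh]
  rw [pairing_eq_integral hf hC hσ hσ]
  have hle (g : Motion n) : R.indicator 1 g * ∫ h, f (h⁻¹ * g) * R.indicator 1 h
      ∂(motionMeasure n) ≤ I.indicator (fun _ => ∫ h, f h ∂(motionMeasure n) + ε) g +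
        (R \ I).indicator (fun _ => ∫ h, |f h| ∂(motionMeasure n)) g := by
    rw [hinner]
    by_cases hgI : g ∈ I
    · have h1 := (abs_le.1 (abs_setIntegral_cylinder_sub_le hint (s := s) hgI)).2
      simp only [hIR hgI, hgI, indicator_of_mem, Pi.one_apply, one_mul, Set.mem_sdiff, not_true,
        and_false, not_false_iff, indicator_of_notMem, add_zero]
      linarith
    by_cases hgR : g ∈ R
    · simp only [hgR, hgI, indicator_of_mem, Pi.one_apply, one_mul, Set.mem_sdiff, not_false_iff,
        and_self, indicator_of_notMem, zero_add]
      calc ∫ h in R, f (h⁻¹ * g) ∂(motionMeasure n)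
          ≤ ∫ h in R, |f (h⁻¹ * g)| ∂(motionMeasure n) :=
            integral_mono (integrable_inv_mul hint g).integrableOn
              (integrable_inv_mul hint g).abs.integrableOn fun h => le_abs_self _
        _ ≤ ∫ h, |f (h⁻¹ * g)| ∂(motionMeasure n) :=
            setIntegral_le_integral (integrable_inv_mul hint g).abs
              (ae_of_all _ fun h => abs_nonneg _)
        _ = ∫ h, |f h| ∂(motionMeasure n) := integral_inv_mul hint.abs.aestronglyMeasurable g
    · simp [hgI, hgR]
  have hdfin : motionMeasure n (R \ I) ≠ ∞ := measure_ne_top_of_subset sdiff_subset hRfin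
  have hIfin : motionMeasure n I ≠ ∞ := motionMeasure_cylinder_ne_top _ _
  have hi1 : Integrable (I.indicator fun _ => ∫ h, f h ∂(motionMeasure n) + ε)
      (motionMeasure n) := (integrable_indicator_iff hI).2 (integrableOn_const hIfin)
  have hi2 : Integrable ((R \ I).indicator fun _ => ∫ h, |f h| ∂(motionMeasure n))
      (motionMeasure n) := (integrable_indicator_iff (hR.diff hI)).2 (integrableOn_const hdfin)
  refine (integral_mono (integrable_mul_integral hf hC hσ hσ) (hi1.add hi2) hle).trans ?_
  simp only [Pi.add_apply]
  rw [integral_add hi1 hi2, integral_indicator hI, integral_indicator (hR.diff hI),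
    setIntegral_const, setIntegral_const, smul_eq_mul, smul_eq_mul,
    measureReal_sdiff hIR hI hRfin, hvol, hvol]

/-! ### Packings -/

theorem move_mul (g h : Motion n) (S : Set (E n)) : move (g * h) S = move g (move h S) := by
  unfold move
  rw [image_image]
  refine image_congr fun y _ => ?_
  change g.1 + rot g.2 h.1 + rot (g.2 * h.2) y = g.1 + rot g.2 (h.1 + rot h.2 y)
  rw [rot_mul, rot_add, add_assoc]

theorem move_eq_vadd (g : Motion n) (S : Set (E n)) :
    move g S = g.1 +ᵥ (rotIsometry g.2 '' S) := by
  rw [← image_vadd, image_image]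
  rfl

theorem isOpen_move (g : Motion n) {S : Set (E n)} (hS : IsOpen S) : IsOpen (move g S) := by
  rw [move_eq_vadd]
  exact ((rotIsometry g.2).toHomeomorph.isOpenMap S hS).vadd g.1

theorem move_interior_subset (g : Motion n) (S : Set (E n)) :
    move g (interior S) ⊆ interior (move g S) :=
  interior_maximal (image_mono interior_subset) (isOpen_move g isOpen_interior)

theorem volume_move (g : Motion n) (S : Set (E n)) : volume (move g S) = volume S := by
  rw [move_eq_vadd, measure_vadd, LinearIsometryEquiv.image_eq_preimage_symm]
  exact (rotIsometry g.2).symm.measurePreserving.measure_preimage_equiv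
    (f := (rotIsometry g.2).symm.toHomeomorph.toMeasurableEquiv) S

theorem inter_move_eq_empty {g h : Motion n} {S : Set (E n)}
    (hgh : Disjoint (interior (move g S)) (interior (move h S))) :
    interior S ∩ move (h⁻¹ * g) (interior S) = ∅ := by
  refine eq_empty_of_forall_notMem fun z hz => ?_
  refine disjoint_left.1 hgh (?_ : h.1 + rot h.2 z ∈ interior (move g S))
    (move_interior_subset h S (mem_image_of_mem _ hz.1))
  refine move_interior_subset g S ?_
  have := mem_image_of_mem (fun y => h.1 + rot h.2 y) hz.2
  rwa [← move, ← move_mul, mul_inv_cancel_left] at this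

/-- The rotations of the copies in a packing may be taken in a transversal of a group of symmetries
of the body. -/
theorem IsPacking.exists_rotations_mem {K P : Set (E n)} (hP : IsPacking K P)
    {G : Subgroup (SO n)} (hG : G ≤ symmetryGroup K) {T : Set (SO n)}
    (hT : Subgroup.IsComplement T (G : Set (SO n))) :
    ∃ S : Set (Motion n), (∀ g ∈ S, g.2 ∈ T) ∧
      S.Pairwise (fun g h => Disjoint (interior (move g K)) (interior (move h K))) ∧
      P = ⋃ g ∈ S, move g K := by
  obtain ⟨S, hS, rfl⟩ := hP
  have hrep (g : Motion n) : ∃ g' : Motion n, g'.2 ∈ T ∧ move g' K = move g K := by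
    obtain ⟨⟨t, k⟩, htk⟩ := hT.2 g.2
    refine ⟨(g.1, t), t.2, ?_⟩
    have hk : rot (k : SO n) '' K = K := hG k.2
    simp only [move]
    conv_lhs => rw [← hk]
    rw [image_image]
    refine image_congr fun y _ => ?_
    rw [← rot_mul, ← htk]
  choose τ hτT hτ using hrep
  refine ⟨τ '' S, ?_, ?_, ?_⟩
  · rintro _ ⟨g, _, rfl⟩
    exact hτT g
  · rintro _ ⟨g, hg, rfl⟩ _ ⟨h, hh, rfl⟩ hne
    rw [hτ, hτ]
    exact hS hg hh fun hgh => hne (congrArg τ hgh)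
  · simp only [biUnion_image, hτ]

/-- If at most `N` of the copies have their translation part in `B(p, r + D)`, where
`K ⊆ B(0, D)`, then `P` covers at most `N vol K` of `B(p, r)`. -/
theorem volume_ball_inter_le {K : Set (E n)} {D : ℝ} (hD : K ⊆ Metric.ball 0 D)
    {S : Set (Motion n)} {p : E n} {r N : ℝ}
    (hN : ∀ F : Finset (Motion n), (∀ g ∈ F, g ∈ S) → (∀ g ∈ F, g ∈ cylinder p (r + D)) →
      (F.card : ℝ) ≤ N) :
    volume (Metric.ball p r ∩ ⋃ g ∈ S, move g K) ≤ ENNReal.ofReal N * volume K := by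
  set S' := S ∩ cylinder p (r + D)
  have hcard : S'.encard ≤ (⌊N⌋₊ : ℕ∞) := by
    by_contra! h
    obtain ⟨t, hts, htc⟩ := exists_subset_encard_eq (Order.add_one_le_of_lt h)
    have hfin : t.Finite := finite_of_encard_eq_coe (k := ⌊N⌋₊ + 1) (by exact_mod_cast htc)
    have h1 := hN hfin.toFinset (fun g hg => (hts (hfin.mem_toFinset.1 hg)).1)
      (fun g hg => (hts (hfin.mem_toFinset.1 hg)).2)
    rw [hfin.encard_eq_coe_toFinset_card] at htc
    have h2 : hfin.toFinset.card = ⌊N⌋₊ + 1 := by exact_mod_cast htc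
    rw [h2] at h1
    push_cast at h1
    linarith [Nat.lt_floor_add_one N]
  obtain ⟨hfin, -⟩ := encard_le_coe_iff_finite_ncard_le.1 hcard
  have hsub : Metric.ball p r ∩ ⋃ g ∈ S, move g K ⊆ ⋃ g ∈ hfin.toFinset, move g K := by
    rintro _ ⟨hz, hzP⟩
    obtain ⟨g, hg, y, hy, rfl⟩ := mem_iUnion₂.1 hzP
    refine mem_iUnion₂.2 ⟨g, hfin.mem_toFinset.2 ⟨hg, ?_, mem_univ _⟩, y, hy, rfl⟩
    have h1 : ‖y‖ < D := mem_ball_zero_iff.1 (hD hy)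
    rw [Metric.mem_ball] at hz ⊢
    have h2 := dist_triangle g.1 (g.1 + rot g.2 y) p
    rw [dist_self_add_right, norm_rot] at h2
    linarith
  calc volume (Metric.ball p r ∩ ⋃ g ∈ S, move g K)
      ≤ volume (⋃ g ∈ hfin.toFinset, move g K) := measure_mono hsub
    _ ≤ ∑ g ∈ hfin.toFinset, volume (move g K) := measure_biUnion_finset_le _ _
    _ = hfin.toFinset.card * volume K := by simp [volume_move]
    _ ≤ ENNReal.ofReal N * volume K := by
        gcongr
        rw [← ENNReal.ofReal_natCast]
        refine ENNReal.ofReal_le_ofReal (hN _ (fun g hg => ?_) fun g hg => ?_)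
        · exact (hfin.mem_toFinset.1 hg).1
        · exact (hfin.mem_toFinset.1 hg).2

theorem le_upperDensity {P : Set (E n)} {Δ : ℝ≥0∞} (h : HasDensity P Δ) : Δ ≤ upperDensity P := by
  rw [← (h 0).limsup_eq]
  exact limsup_le_limsup (Eventually.of_forall fun r =>
    le_iSup (fun p => coveredFraction P p r) 0)

/-! ### The bound -/

/-- The bound on the upper density at a positive error `ε`, which measures the tail of `f`. -/
theorem upperDensity_le_of_tail {K : Set (E n)} (hK : Bornology.IsBounded K) {f : Motion n → ℝ}
    (hint : Integrable f (motionMeasure n)) (hf : Continuous f)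
    (hpos : IsPositiveType fun g => (f g : ℂ)) {S : Set (Motion n)}
    (hS : ∀ g ∈ S, ∀ h ∈ S, g ≠ h → f (h⁻¹ * g) ≤ 0) {ε : ℝ} (hε : 0 < ε)
    (hεlt : ε < ∫ g, f g ∂(motionMeasure n)) :
    upperDensity (⋃ g ∈ S, move g K) ≤
      ENNReal.ofReal (f 1 / (∫ g, f g ∂(motionMeasure n) - ε) ^ 2 * volume.real K *
        (∫ g, f g ∂(motionMeasure n) + ε)) := by
  set lam := ∫ g, f g ∂(motionMeasure n)
  set L := ∫ g, |f g| ∂(motionMeasure n)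
  have hL : 0 ≤ L := integral_nonneg fun _ => abs_nonneg _
  obtain ⟨C, hC⟩ := hpos.bounded
  replace hC (g : Motion n) : |f g| ≤ C := by simpa using hC g
  obtain ⟨s, hs, htail⟩ := exists_tail_le hint hε
  obtain ⟨D, hD0, hKD⟩ := hK.subset_ball_lt 0 0
  have hf1 := apply_one_nonneg hpos hf
  have ha : 0 < lam - ε := sub_pos.2 hεlt
  set c := volume.real (Metric.ball (0 : E n) 1)
  have hc : 0 < c := ENNReal.toReal_pos (Metric.measure_ball_pos _ _ one_pos).ne' measure_ball_lt_top.ne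
  have hball (p : E n) {r : ℝ} (hr : 0 < r) : volume.real (Metric.ball p r) = r ^ n * c := by
    rw [measureReal_def, Measure.addHaar_ball_of_pos _ _ hr, finrank_euclideanSpace_fin,
      ENNReal.toReal_mul, ENNReal.toReal_ofReal (by positivity)]
    rfl
  -- `w r` bounds the self-pairing of the cylinder of radius `r + D + s`
  let w (r : ℝ) : ℝ := (r + D) ^ n * c * (lam + ε) + ((r + D + s) ^ n * c - (r + D) ^ n * c) * L
  have hlayer {r : ℝ} (hr : 0 < r) : (r + D) ^ n * c ≤ (r + D + s) ^ n * c := by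
    gcongr ?_ ^ n * c
    linarith
  have hw {r : ℝ} (hr : 0 < r) : 0 < w r := by
    have h1 : 0 < (r + D) ^ n * c * (lam + ε) := by
      have : 0 < r + D := by linarith
      have : 0 < lam + ε := by linarith
      positivity
    have h2 := mul_nonneg (sub_nonneg.2 (hlayer hr)) hL
    linarith
  have hcount (p : E n) {r : ℝ} (hr : 0 < r) (F : Finset (Motion n)) (hFS : ∀ g ∈ F, g ∈ S)
      (hFc : ∀ g ∈ F, g ∈ cylinder p (r + D)) :
      (F.card : ℝ) ≤ f 1 * w r / (lam - ε) ^ 2 := by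
    rw [le_div_iff₀ (by positivity)]
    have hR : MeasurableSet (cylinder p (r + D + s)) := (isOpen_cylinder _ _).measurableSet
    refine card_mul_sq_le hpos hf (U := cylinder p (r + D))
      (σ := (cylinder p (r + D + s)).indicator 1)
      (fun g hg h hh hne => hS g (hFS g hg) h (hFS h hh) hne) (isOpen_cylinder _ _)
      (motionMeasure_cylinder_ne_top _ _) hFc ((integrable_indicator_iff hR).2
        (integrableOn_const (motionMeasure_cylinder_ne_top _ _))) ha.le (fun g hg => ?_) (hw hr) ?_
    · have h1 := (abs_le.1 ((abs_setIntegral_cylinder_sub_le hint (s := s) hg).trans htail)).1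
      rw [← integral_indicator hR] at h1
      have h2 : (fun h => f (h⁻¹ * g) * (cylinder p (r + D + s)).indicator 1 h) =
          (cylinder p (r + D + s)).indicator fun h => f (h⁻¹ * g) := by
        ext h
        by_cases hh : h ∈ cylinder p (r + D + s) <;> simp [hh]
      rw [h2]
      linarith
    · refine (pairing_cylinder_le hf hC hint hs.le htail p (r + D)).trans_eq ?_
      rw [hball p (by linarith), hball p (by linarith)]
  let b (r : ℝ) : ℝ := f 1 / (lam - ε) ^ 2 * volume.real K *
    ((1 + D / r) ^ n * (lam + ε) + ((1 + (D + s) / r) ^ n - (1 + D / r) ^ n) * L)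
  have hcov (p : E n) {r : ℝ} (hr : 0 < r) :
      coveredFraction (⋃ g ∈ S, move g K) p r ≤ ENNReal.ofReal (b r) := by
    have hN0 : 0 ≤ f 1 * w r / (lam - ε) ^ 2 := by
      have := hw hr
      positivity
    have hV := volume_ball_inter_le hKD (S := S) (p := p) (r := r) (hcount p hr)
    have hKfin : volume K ≠ ∞ := hK.measure_lt_top.ne
    unfold coveredFraction
    refine (ENNReal.div_le_div_right hV _).trans_eq ?_
    rw [← ofReal_measureReal hKfin, ← ofReal_measureReal (s := Metric.ball p r)
      measure_ball_lt_top.ne, hball p hr, ← ENNReal.ofReal_mul hN0,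
      ← ENNReal.ofReal_div_of_pos (by positivity)]
    congr 1
    have e1 : (1 + D / r) ^ n = (r + D) ^ n / r ^ n := by
      rw [← div_pow, add_div, div_self hr.ne']
    have e2 : (1 + (D + s) / r) ^ n = (r + D + s) ^ n / r ^ n := by
      rw [← div_pow, add_assoc r, add_div r, div_self hr.ne']
    simp only [b, w, e1, e2]
    field_simp
  have hlim : Tendsto b atTop (𝓝 (f 1 / (lam - ε) ^ 2 * volume.real K * (lam + ε))) := by
    have h (d : ℝ) : Tendsto (fun r : ℝ => (1 + d / r) ^ n) atTop (𝓝 1) := by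
      simpa using ((tendsto_const_nhds (x := d)).div_atTop tendsto_id |>.const_add 1).pow n
    have := (((h D).mul_const (lam + ε)).add (((h (D + s)).sub (h D)).mul_const L)).const_mul
      (f 1 / (lam - ε) ^ 2 * volume.real K)
    simpa using this
  rw [← (ENNReal.tendsto_ofReal hlim).limsup_eq]
  exact limsup_le_limsup ((eventually_gt_atTop 0).mono fun r hr => iSup_le fun p => hcov p hr)

end BodyPacking

theorem theorem3 (n : ℕ) (K : ConvexBody (BodyPacking.E n))
    (hK : (interior (K : Set (BodyPacking.E n))).Nonempty)
    (G : Subgroup (BodyPacking.SO n))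
    (hG : G ≤ BodyPacking.symmetryGroup (K : Set (BodyPacking.E n)))
    (T : Set (BodyPacking.SO n))
    (hT : Subgroup.IsComplement T (G : Set (BodyPacking.SO n)))
    (f : BodyPacking.Motion n → ℝ)
    (hf_int : Integrable f (BodyPacking.motionMeasure n))
    (hf_bdd : ∃ C : ℝ, ∀ g, |f g| ≤ C)
    (hf_cont : Continuous f)
    (hf_pos : BodyPacking.IsPositiveType (fun g => (f g : ℂ)))
    (hf_nonpos : ∀ (x : BodyPacking.E n) (A : BodyPacking.SO n), A ∈ T⁻¹ * T →
      interior (K : Set (BodyPacking.E n)) ∩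
        BodyPacking.move (x, A) (interior (K : Set (BodyPacking.E n))) = ∅ → f (x, A) ≤ 0)
    (hf_integral : 0 < ∫ g, f g ∂(BodyPacking.motionMeasure n))
    (P : Set (BodyPacking.E n)) (hP : BodyPacking.IsPacking (K : Set (BodyPacking.E n)) P) :
    BodyPacking.upperDensity P ≤
        ENNReal.ofReal (f (0, 1) / (∫ g, f g ∂(BodyPacking.motionMeasure n)) *
          (volume (K : Set (BodyPacking.E n))).toReal) ∧
      ∀ Δ : ENNReal, BodyPacking.HasDensity P Δ →
        Δ ≤ ENNReal.ofReal (f (0, 1) / (∫ g, f g ∂(BodyPacking.motionMeasure n)) *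
          (volume (K : Set (BodyPacking.E n))).toReal) := by
  refine (fun h => ⟨h, fun Δ hΔ => (BodyPacking.le_upperDensity hΔ).trans h⟩) ?_
  obtain ⟨S, hST, hS, rfl⟩ := hP.exists_rotations_mem hG hT
  have hS' (g : BodyPacking.Motion n) (hg : g ∈ S) (h : BodyPacking.Motion n) (hh : h ∈ S)
      (hne : g ≠ h) : f (h⁻¹ * g) ≤ 0 :=
    hf_nonpos _ _ (Set.mul_mem_mul (Set.inv_mem_inv.2 (hST h hh)) (hST g hg))
      (BodyPacking.inter_move_eq_empty (hS hg hh hne))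
  set lam := ∫ g, f g ∂(BodyPacking.motionMeasure n)
  have hne : (lam - 0) ^ 2 ≠ 0 := by rw [sub_zero]; positivity
  have hlim : Tendsto (fun ε : ℝ => ENNReal.ofReal (f 1 / (lam - ε) ^ 2 *
      volume.real (K : Set (BodyPacking.E n)) * (lam + ε))) (𝓝[>] 0)
      (𝓝 (ENNReal.ofReal (f 1 / (lam - 0) ^ 2 *
        volume.real (K : Set (BodyPacking.E n)) * (lam + 0)))) := by
    refine ENNReal.tendsto_ofReal (tendsto_nhdsWithin_of_tendsto_nhds ?_)
    have h1 : Tendsto (fun ε : ℝ => (lam - ε) ^ 2) (𝓝 0) (𝓝 ((lam - 0) ^ 2)) :=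
      Continuous.tendsto (by fun_prop) 0
    exact ((tendsto_const_nhds.div h1 hne).mul_const _).mul (tendsto_id.const_add lam)
  have hval : f 1 / (lam - 0) ^ 2 * volume.real (K : Set (BodyPacking.E n)) * (lam + 0) =
      f (0, 1) / lam * (volume (K : Set (BodyPacking.E n))).toReal := by
    change f (0, 1) / (lam - 0) ^ 2 * (volume (K : Set (BodyPacking.E n))).toReal * (lam + 0) = _
    rw [sub_zero, add_zero]
    field_simp
  rw [hval] at hlim
  refine ge_of_tendsto hlim ?_
  filter_upwards [Ioo_mem_nhdsGT hf_integral] with ε hε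
  exact BodyPacking.upperDensity_le_of_tail K.isCompact.isBounded hf_int hf_cont hf_pos hS'
    hε.1 hε.2
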